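/- Let $R$ be a Dedekind domain (an integral domain in which every ideal is projective; fields are allowed), and let $M$ and $N$ be finitely generated $R$-modules. For modules $A,B$ over a commutative ring $S$, let $\operatorname{inj}_S(A,B)\in\{0,1,2,\dots\}\cup\{\infty\}$ denote the supremum of the nonnegative integers $t$ such that there exists an injective $S$-linear map $B^{\oplus t}\to A$. Let $\operatorname{Ass}_R(N)$ denote the set of associated primes of $N$ (the prime ideals that are annihilators of elements of $N$). Then $$\operatorname{inj}_R(M,N)=\inf\{\operatorname{inj}_{R_{\mathfrak p}}(M_{\mathfrak p},N_{\mathfrak p}) : \mathfrak p\in\operatorname{Ass}_R(N)\},$$ where the infimum of the empty set (the case $N=0$) is $\infty$. -/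

import Mathlib

/-- The injective capacity of `M` with respect to `N` over `R`: the supremum, in `ℕ∞`, of the
natural numbers `t` for which there is an injective `R`-linear map `N ^ t → M`. -/
noncomputable def injCapacity (R : Type*) [CommRing R] (M N : Type*)
    [AddCommGroup M] [Module R M] [AddCommGroup N] [Module R N] : ℕ∞ :=
  sSup {c : ℕ∞ | ∃ t : ℕ, c = t ∧ ∃ f : (Fin t → N) →ₗ[R] M, Function.Injective f}

/-- The local injective capacity of `M` with respect to `N` at a prime `p` of `R`: the injective
capacity of `M_p` with respect to `N_p` over the local ring `R_p`. -/
noncomputable def localInjCapacity (R : Type*) [CommRing R] (p : PrimeSpectrum R) (M N : Type*)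
    [AddCommGroup M] [Module R M] [AddCommGroup N] [Module R N] : ℕ∞ :=
  injCapacity (Localization.AtPrime p.asIdeal)
    (LocalizedModule.AtPrime p.asIdeal M) (LocalizedModule.AtPrime p.asIdeal N)

/-! Localization is exact, which gives one inequality. Conversely, a nonzero kernel over a
Noetherian ring has an associated prime, so injectivity only has to be checked on elements whose
annihilator is an associated prime. If `t` is at most every local capacity, clearing denominators in
the local injections gives, for each such prime, a global map `N ^ t → M` good at that prime. These
must be merged into one map. The associated primes are finitely many maximal ideals and possibly
`⊥`. The Chinese remainder theorem merges the maximal ones, since elements of `p` kill every element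
with annihilator `p`. If `⊥` is not maximal, perturb the result `f` to `f + (c * r) • g`, with `g`
good at `⊥` and `c ≠ 0` in all those maximal ideals. Only finitely many `r` fail, by an eigenvalue
count over the fraction field. -/

/-- The map `f` does not kill any element whose annihilator is `p`. -/
def LinearMap.NonvanishingAt {R M N : Type*} [CommRing R] [AddCommGroup M] [Module R M]
    [AddCommGroup N] [Module R N] (f : N →ₗ[R] M) (p : Ideal R) : Prop :=
  ∀ x : N, (⊥ : Submodule R N).colon {x} = p → f x ≠ 0

section NonvanishingAt

variable {R M N : Type*} [CommRing R] [AddCommGroup M] [Module R M] [AddCommGroup N] [Module R N]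

/-- Over a Noetherian ring, injectivity can be tested on elements whose annihilators are
associated primes. -/
theorem LinearMap.injective_of_nonvanishingAt [IsNoetherianRing R] (f : N →ₗ[R] M)
    (hf : ∀ p ∈ associatedPrimes R N, f.NonvanishingAt p) : Function.Injective f := by
  rw [← LinearMap.ker_eq_bot, ← Submodule.subsingleton_iff_eq_bot]
  by_contra hK
  rw [not_subsingleton_iff_nontrivial] at hK
  obtain ⟨p, hp⟩ := associatedPrimes.nonempty R (LinearMap.ker f)
  have hpN := associatedPrimes.subset_of_injective (LinearMap.ker f).injective_subtype hp
  obtain ⟨-, x, rfl⟩ := isAssociatedPrime_iff.mp hp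
  refine hf _ hpN x.1 ?_ x.2
  ext r
  simp [Submodule.mem_colon_singleton, ← Subtype.coe_inj]

/-- The associated primes of a finite power of `N` are associated primes of `N`. -/
theorem associatedPrimes_pi_subset [IsNoetherianRing R] {ι : Type*} [Finite ι] :
    associatedPrimes R (ι → N) ⊆ associatedPrimes R N := by
  cases nonempty_fintype ι
  intro p hp
  obtain ⟨hprime, x, hx⟩ := isAssociatedPrime_iff.mp hp
  -- A prime that is a finite intersection of ideals equals one of them.
  have hinf : p = Finset.univ.inf fun i => (⊥ : Submodule R N).colon {x i} := by
    rw [hx]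
    ext r
    simp [Submodule.mem_colon_singleton, Submodule.mem_finsetInf, funext_iff]
  obtain ⟨i, -, hi⟩ := (Ideal.IsPrime.inf_le' hprime).mp hinf.ge
  refine isAssociatedPrime_iff.mpr ⟨hprime, x i, le_antisymm ?_ hi⟩
  exact hinf.le.trans (Finset.inf_le (Finset.mem_univ i))

/-- An injective map between localizations at `p` lifts, up to a unit, to a global map that does
not vanish on elements with annihilator `p`. -/
theorem exists_nonvanishingAt_of_localized_injective [Module.FinitePresentation R N]
    (p : Ideal R) [p.IsPrime] {N' M' : Type*} [AddCommGroup N'] [Module R N'] [AddCommGroup M']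
    [Module R M'] (g : N →ₗ[R] N') (h : M →ₗ[R] M') [IsLocalizedModule p.primeCompl g]
    [IsLocalizedModule p.primeCompl h] (φ : N' →ₗ[R] M') (hφ : Function.Injective φ) :
    ∃ f : N →ₗ[R] M, f.NonvanishingAt p := by
  obtain ⟨f, s, hfs⟩ := Module.FinitePresentation.exists_lift_of_isLocalizedModule
    p.primeCompl h (φ ∘ₗ g)
  refine ⟨f, fun x hx hfx => ?_⟩
  have h1 : s • φ (g x) = 0 := by
    have := LinearMap.congr_fun hfs x
    simpa [hfx] using this.symm
  have h2 : φ (g x) = 0 :=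
    IsLocalizedModule.smul_injective h s (by simpa using h1)
  have h3 : g x = 0 := hφ (by rw [h2, map_zero])
  obtain ⟨c, hc⟩ := (IsLocalizedModule.eq_zero_iff p.primeCompl g).mp h3
  have hcx : (c : R) ∈ (⊥ : Submodule R N).colon {x} := Submodule.mem_colon_singleton.mpr hc
  rw [hx] at hcx
  exact c.2 hcx

/-- Altering a map by a multiple of an element of `p` preserves nonvanishing at `p`. -/
theorem LinearMap.NonvanishingAt.smul_add_smul {p : Ideal R} [p.IsPrime] {f : N →ₗ[R] M}
    (hf : f.NonvanishingAt p) (hmax : p.IsMaximal) {a : R} (ha : a ∉ p) {g : N →ₗ[R] M}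
    (hg : ∀ x, (⊥ : Submodule R N).colon {x} = p → g x = 0) : (a • f + g).NonvanishingAt p := by
  intro x hx h0
  rw [LinearMap.add_apply, hg x hx, add_zero, LinearMap.smul_apply] at h0
  obtain ⟨b, i, hi, hb⟩ := hmax.exists_inv ha
  have hix : i • x = 0 := by
    rw [← hx, Submodule.mem_colon_singleton] at hi
    simpa using hi
  refine hf x hx ?_
  calc f x = (b * a + i) • f x := by rw [hb, one_smul]
    _ = 0 := by rw [add_smul, mul_smul, h0, smul_zero, ← map_smul, hix, map_zero, add_zero]

/-- Maps that do not vanish at finitely many maximal ideals can be glued. -/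
theorem exists_nonvanishingAt_of_finite_maximal {S : Set (Ideal R)} (hS : S.Finite)
    (hmax : ∀ p ∈ S, p.IsMaximal) (h : ∀ p ∈ S, ∃ f : N →ₗ[R] M, f.NonvanishingAt p) :
    ∃ f : N →ₗ[R] M, ∀ p ∈ S, f.NonvanishingAt p := by
  classical
  have := hS.fintype
  choose f hf using fun p : S => h p p.2
  have hcop : Pairwise (Function.onFun IsCoprime fun p : S => (p : Ideal R)) := by
    intro p q hpq
    have := hmax p p.2
    have := hmax q q.2
    exact Ideal.isCoprime_of_isMaximal (fun h => hpq (Subtype.ext h))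
  -- `e p` is 1 modulo `p` and 0 modulo every other member of `S`.
  choose e he using fun p : S => Ideal.exists_forall_sub_mem_ideal hcop (Pi.single p (1 : R))
  refine ⟨∑ p, e p • f p, fun p hp => ?_⟩
  have hpm := hmax p hp
  rw [← Finset.add_sum_erase _ _ (Finset.mem_univ (⟨p, hp⟩ : S))]
  refine (hf ⟨p, hp⟩).smul_add_smul hpm ?_ ?_
  · intro hmem
    have h1 := he ⟨p, hp⟩ ⟨p, hp⟩
    rw [Pi.single_eq_same] at h1
    exact hpm.ne_top ((Ideal.eq_top_iff_one _).mpr (by simpa using sub_mem hmem h1))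
  · intro x hx
    rw [LinearMap.sum_apply]
    refine Finset.sum_eq_zero fun q hq => ?_
    have h1 := he q ⟨p, hp⟩
    rw [Pi.single_eq_of_ne (Finset.ne_of_mem_erase hq).symm, sub_zero] at h1
    have h2 : e q • x = 0 := by
      rw [← hx, Submodule.mem_colon_singleton] at h1
      simpa using h1
    rw [LinearMap.smul_apply, ← map_smul, h2, map_zero]

/-- Over an infinite domain, a map that does not vanish at `⊥` can be added, after scaling by a
suitable multiple of a nonzero element, to any other map so that the sum does not vanish at `⊥`. -/
theorem exists_add_smul_nonvanishingAt_bot [IsDomain R] [Infinite R] [Module.Finite R N]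
    (f g : N →ₗ[R] M) (hg : g.NonvanishingAt ⊥) {c : R} (hc : c ≠ 0) :
    ∃ r : R, (f + (c * r) • g).NonvanishingAt ⊥ := by
  let S := nonZeroDivisors R
  let K := FractionRing R
  let i := LocalizedModule.mkLinearMap S N
  let j := LocalizedModule.mkLinearMap S M
  let A := IsLocalizedModule.mapExtendScalars S i j K f
  let B := IsLocalizedModule.mapExtendScalars S i j K g
  have hA (x : N) : A (i x) = j (f x) := IsLocalizedModule.map_apply S i j f x
  have hB (x : N) : B (i x) = j (g x) := IsLocalizedModule.map_apply S i j g x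
  have hfree (x : N) : (⊥ : Submodule R N).colon {x} = ⊥ ↔ i x ≠ 0 := by
    rw [Ne, IsLocalizedModule.eq_zero_iff S i, eq_bot_iff]
    constructor
    · rintro h ⟨s, hs⟩
      exact nonZeroDivisors.coe_ne_zero s (h (Submodule.mem_colon_singleton.mpr hs))
    · intro h r hr
      by_contra hr0
      exact h ⟨⟨r, mem_nonZeroDivisors_of_ne_zero hr0⟩,
        by simpa [Submodule.mem_colon_singleton] using hr⟩
  have hBinj : LinearMap.ker B = ⊥ := by
    rw [eq_bot_iff]
    intro y hy
    obtain ⟨⟨x, s⟩, rfl⟩ := IsLocalizedModule.mk'_surjective S i y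
    simp only [Function.uncurry_apply_pair] at hy ⊢
    have hy' : IsLocalizedModule.mk' j (g x) s = 0 := by
      rw [← IsLocalizedModule.map_mk' S i j g x s]; exact hy
    rw [IsLocalizedModule.mk'_eq_zero, IsLocalizedModule.eq_zero_iff S j] at hy'
    obtain ⟨t, ht⟩ := hy'
    rw [Submodule.mem_bot, IsLocalizedModule.mk'_eq_zero]
    by_contra hx
    have htx : i ((t : R) • x) ≠ 0 := by
      rw [map_smul]
      exact fun h => hx (IsLocalizedModule.smul_injective i t (h.trans (smul_zero t).symm))
    exact hg _ ((hfree _).mpr htx) (by rw [map_smul]; exact ht)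
  obtain ⟨L, hL⟩ := B.exists_leftInverse_of_injective hBinj
  -- If `f + (c * r) • g` kills a non-torsion `x`, applying `L` makes `i x` an eigenvector of `L ∘ₗ
  -- A` with eigenvalue `-(c * r)`.
  have hfin : {r : R | Module.End.HasEigenvalue (L ∘ₗ A) (-(algebraMap R K (c * r)))}.Finite := by
    refine (Module.End.finite_hasEigenvalue (L ∘ₗ A)).preimage (Function.Injective.injOn ?_)
    intro r r' h
    exact mul_left_cancel₀ hc (IsFractionRing.injective R K (neg_injective h))
  obtain ⟨r, hr⟩ := hfin.exists_notMem
  refine ⟨r, fun x hx h0 => hr ?_⟩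
  refine Module.End.hasEigenvalue_of_hasEigenvector (x := i x)
    (Module.End.hasEigenvector_iff.mpr ⟨Module.End.mem_eigenspace_iff.mpr ?_, (hfree x).mp hx⟩)
  have h1 : A (i x) + algebraMap R K (c * r) • B (i x) = 0 := by
    rw [hA, hB, algebraMap_smul, ← map_smul, ← map_add]
    simpa using congrArg j h0
  have h2 : L (B (i x)) = i x := LinearMap.congr_fun hL (i x)
  have h3 := congrArg L h1
  rw [map_add, map_smul, h2, map_zero] at h3
  rw [neg_smul]
  exact eq_neg_of_add_eq_zero_left h3

/-- Over a Dedekind domain, if for every associated prime `p` of `N` some linear map `N → M` does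
not vanish at `p`, then `N` embeds in `M`. -/
theorem exists_injective_of_forall_nonvanishingAt [IsDedekindDomain R] [Module.Finite R N]
    (h : ∀ p ∈ associatedPrimes R N, ∃ f : N →ₗ[R] M, f.NonvanishingAt p) :
    ∃ f : N →ₗ[R] M, Function.Injective f := by
  classical
  have hfin : {p ∈ associatedPrimes R N | p.IsMaximal}.Finite :=
    (associatedPrimes.finite R N).subset (Set.sep_subset _ _)
  obtain ⟨f, hf⟩ := exists_nonvanishingAt_of_finite_maximal hfin (fun p hp => hp.2)
    (fun p hp => h p hp.1)
  -- Over a field `⊥` is itself maximal, so the gluing above already covers it.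
  by_cases h0 : (⊥ : Ideal R) ∈ associatedPrimes R N ∧ ¬ (⊥ : Ideal R).IsMaximal
  · obtain ⟨hbot, hnm⟩ := h0
    obtain ⟨g, hg⟩ := h ⊥ hbot
    have hnf : ¬ IsField R := fun hR => hnm (Ring.isField_iff_maximal_bot.mp hR)
    have : Infinite R := by
      by_contra hR
      rw [not_infinite_iff_finite] at hR
      exact hnf (Finite.isField_of_domain R)
    have hne (p : Ideal R) (hp : p ∈ hfin.toFinset) : ∃ c ∈ p, c ≠ 0 := by
      refine (Submodule.ne_bot_iff p).mp fun hpb => hnm ?_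
      rw [← hpb]
      exact ((Set.Finite.mem_toFinset hfin).mp hp).2
    choose! c hcp hc0 using hne
    have hprod : ∏ p ∈ hfin.toFinset, c p ≠ 0 := Finset.prod_ne_zero_iff.mpr hc0
    obtain ⟨r, hr⟩ := exists_add_smul_nonvanishingAt_bot f g hg hprod
    refine ⟨f + ((∏ p ∈ hfin.toFinset, c p) * r) • g, LinearMap.injective_of_nonvanishingAt _ fun p hp => ?_⟩
    by_cases hpb : p = ⊥
    · rw [hpb]; exact hr
    · have := hp.isPrime
      have hpm : p.IsMaximal := Ideal.IsPrime.isMaximal this hpb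
      have hpS := (Set.Finite.mem_toFinset hfin).mpr ⟨hp, hpm⟩
      rw [← one_smul R f]
      refine (hf p ⟨hp, hpm⟩).smul_add_smul hpm (fun h1 => hpm.ne_top
        ((Ideal.eq_top_iff_one p).mpr h1)) fun x hx => ?_
      have hmem : (∏ p ∈ hfin.toFinset, c p) * r ∈ (⊥ : Submodule R N).colon {x} := by
        rw [hx]
        exact p.mul_mem_right _ (Ideal.mem_of_dvd _ (Finset.dvd_prod_of_mem c hpS) (hcp p hpS))
      rw [Submodule.mem_colon_singleton, Submodule.mem_bot] at hmem
      rw [LinearMap.smul_apply, ← map_smul, hmem, map_zero]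
  · refine ⟨f, LinearMap.injective_of_nonvanishingAt f fun p hp => hf p ⟨hp, ?_⟩⟩
    have := hp.isPrime
    by_cases hpb : p = ⊥
    · subst hpb
      by_contra hm
      exact h0 ⟨hp, hm⟩
    · exact Ideal.IsPrime.isMaximal this hpb

end NonvanishingAt

section InjCapacity

variable {R M N : Type*} [CommRing R] [AddCommGroup M] [Module R M] [AddCommGroup N] [Module R N]

theorem le_injCapacity {t : ℕ} (f : (Fin t → N) →ₗ[R] M) (hf : Function.Injective f) :
    (t : ℕ∞) ≤ injCapacity R M N :=
  le_sSup ⟨t, rfl, f, hf⟩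

theorem exists_injective_of_le_injCapacity {t : ℕ} (ht : (t : ℕ∞) ≤ injCapacity R M N) :
    ∃ f : (Fin t → N) →ₗ[R] M, Function.Injective f := by
  obtain rfl | ht0 := Nat.eq_zero_or_pos t
  · exact ⟨0, Function.injective_of_subsingleton _⟩
  -- The supremum need not be attained when infinite; exceeding `t - 1` yields some `s ≥ t`, and `N
  -- ^ t` embeds in `N ^ s` by zero padding.
  have hlt : ((t - 1 : ℕ) : ℕ∞) < injCapacity R M N :=
    lt_of_lt_of_le (by exact_mod_cast Nat.sub_lt ht0 one_pos) ht
  obtain ⟨-, ⟨s, rfl, f, hf⟩, hs⟩ := lt_sSup_iff.mp hlt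
  have hts : t ≤ s := by
    have : t - 1 < s := by exact_mod_cast hs
    omega
  let e : (Fin t → N) →ₗ[R] (Fin s → N) :=
    .pi fun k => if hk : (k : ℕ) < t then .proj ⟨k, hk⟩ else 0
  have he (x : Fin t → N) (k : Fin t) : e x (Fin.castLE hts k) = x k := by simp [e]
  refine ⟨f ∘ₗ e, ?_⟩
  refine hf.comp fun x y hxy => funext fun k => ?_
  rw [← he x, ← he y, hxy]

/-- The capacity can only grow under localization at a prime. -/
theorem injCapacity_le_localInjCapacity (p : PrimeSpectrum R) :
    injCapacity R M N ≤ localInjCapacity R p M N := by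
  refine sSup_le ?_
  rintro _ ⟨t, rfl, f, hf⟩
  let S := p.asIdeal.primeCompl
  let i : (Fin t → N) →ₗ[R] (Fin t → LocalizedModule S N) :=
    .pi fun k => LocalizedModule.mkLinearMap S N ∘ₗ .proj k
  exact le_injCapacity
    (IsLocalizedModule.mapExtendScalars S i (LocalizedModule.mkLinearMap S M)
      (Localization.AtPrime p.asIdeal) f)
    (IsLocalizedModule.map_injective S i (LocalizedModule.mkLinearMap S M) f hf)

end InjCapacity

theorem mainTheorem11 (R : Type*) [CommRing R] [IsDedekindDomain R] (M N : Type*)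
    [AddCommGroup M] [Module R M] [Module.Finite R M]
    [AddCommGroup N] [Module R N] [Module.Finite R N] :
    injCapacity R M N =
      sInf {c : ℕ∞ | ∃ p : PrimeSpectrum R,
        p.asIdeal ∈ associatedPrimes R N ∧ c = localInjCapacity R p M N} := by
  refine le_antisymm (le_sInf ?_) (ENat.forall_natCast_le_iff_le.mp fun t ht => ?_)
  · rintro _ ⟨p, -, rfl⟩
    exact injCapacity_le_localInjCapacity p
  have : Module.FinitePresentation R (Fin t → N) := Module.finitePresentation_of_finite R _
  have hloc : ∀ p ∈ associatedPrimes R (Fin t → N),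
      ∃ f : (Fin t → N) →ₗ[R] M, f.NonvanishingAt p := by
    intro p hp
    have hpN := associatedPrimes_pi_subset hp
    have hprime := hpN.isPrime
    obtain ⟨φ, hφ⟩ := exists_injective_of_le_injCapacity
      (ht.trans (sInf_le ⟨⟨p, hprime⟩, hpN, rfl⟩))
    exact exists_nonvanishingAt_of_localized_injective p
      (.pi fun k => LocalizedModule.mkLinearMap p.primeCompl N ∘ₗ .proj k)
      (LocalizedModule.mkLinearMap p.primeCompl M) (φ.restrictScalars R) hφ
  obtain ⟨f, hf⟩ := exists_injective_of_forall_nonvanishingAt hloc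
  exact le_injCapacity f hf
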